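/- Let $\mathbb D$ be the open unit disk with normalized area measure $dA=\frac1\pi\,r\,dr\,d\theta$, let $L^2_h$ be the harmonic Bergman space, i.e. the closed subspace of $L^2(\mathbb D,dA)$ consisting of the square-integrable complex-valued harmonic functions on $\mathbb D$, and let $Q$ be the orthogonal projection of $L^2(\mathbb D,dA)$ onto $L^2_h$. For $f\in L^\infty(\mathbb D)$ the Toeplitz operator $T_f$ on $L^2_h$ is $T_f u=Q(fu)$; an operator on $L^2_h$ is called a Toeplitz operator if it equals $T_f$ for some $f\in L^\infty(\mathbb D)$. A radial function on $\mathbb D$ is identified with a function of $r=|z|\in(0,1)$; for bounded radial $\phi$ and $\operatorname{Re} z>0$ let $\widehat\phi(z)=\int_0^1\phi(r)r^{z-1}\,dr$ be its Mellin transform, and for $p\in\mathbb Z$ let $e^{ip\theta}\phi$ denote the function $re^{i\theta}\mapsto e^{ip\theta}\phi(r)$. Let $p$ be a nonzero integer and let $\phi$ be a bounded radial function such that $\widehat\phi(2k+|p|+2)\neq0$ for all integers $k\ge0$. If $\psi$ is a bounded radial function such that the product $T_{e^{ip\theta}\phi}T_\psi$ is a Toeplitz operator, then $\psi$ is constant (almost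 everywhere). -/

import Mathlib

namespace HarmonicBergman

open MeasureTheory Complex Metric Set Filter Topology InnerProductSpace
open scoped ENNReal Real

noncomputable section

/-- The normalized area measure `dA = r dr dθ / π` of the open unit disk. -/
def diskMeasure : Measure ℂ := (ENNReal.ofReal π)⁻¹ • volume.restrict (ball (0 : ℂ) 1)

/-- `L²(𝔻, dA)`. -/
abbrev L2Disk : Type := Lp ℂ 2 diskMeasure

/-- `L^∞(𝔻)`, the space of bounded symbols. -/
abbrev LinftyDisk : Type := Lp ℂ ∞ diskMeasure

/-- The harmonic Bergman space `L²_h`: all (classes of) square integrable harmonic functions on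
the unit disk. -/
def harmonicBergman : Submodule ℂ L2Disk where
  carrier := {u | ∃ f : ℂ → ℂ, HarmonicOnNhd f (ball 0 1) ∧ u =ᵐ[diskMeasure] f}
  add_mem' := by
    rintro u v ⟨f, hf, huf⟩ ⟨g, hg, hvg⟩
    exact ⟨f + g, hf.add hg, (Lp.coeFn_add u v).trans (huf.add hvg)⟩
  zero_mem' := ⟨fun _ => 0, fun z _ => analyticAt_const.harmonicAt, Lp.coeFn_zero _ _ _⟩
  smul_mem' := by
    rintro c u ⟨f, hf, huf⟩
    refine ⟨c • f, ?_, (Lp.coeFn_smul c u).trans (huf.const_smul c)⟩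
    exact hf.comp_CLM ((ContinuousLinearMap.mul ℂ ℂ c).restrictScalars ℝ)

/-! ### `L²_h` is closed, so that the orthogonal projection onto it exists -/

/-- A locally uniform limit of harmonic functions is harmonic (real case). -/
theorem harmonicOnNhd_of_tendsto_real {f : ℕ → ℂ → ℝ} {F : ℂ → ℝ}
    (hf : ∀ n, HarmonicOnNhd (f n) (ball 0 1))
    (hF : ∀ r < 1, TendstoUniformlyOn f F atTop (ball 0 r)) :
    HarmonicOnNhd F (ball 0 1) := by
  intro z hz
  obtain ⟨r, hzr, hr1⟩ := exists_between (show ‖z‖ < 1 by simpa using hz)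
  have hr0 : 0 < r := (norm_nonneg z).trans_lt hzr
  obtain ⟨s, hrs, hs1⟩ := exists_between hr1
  have hcontn : ∀ n, ContinuousOn (f n) (ball 0 1) := fun n => (hf n).continuousOn
  have hFc : ContinuousOn F (ball 0 s) :=
    (hF s hs1).continuousOn (Frequently.of_forall fun n =>
      (hcontn n).mono (ball_subset_ball hs1.le))
  have hsph : sphere (0 : ℂ) r ⊆ ball 0 s := sphere_subset_closedBall.trans
    (closedBall_subset_ball hrs)
  have hker : ∀ w ∈ ball (0 : ℂ) r, ContinuousOn (herglotzRieszKernel 0 w) (sphere 0 r) := by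
    intro w hw
    rw [herglotzRieszKernel_fun_def]
    apply ContinuousOn.div (by fun_prop) (by fun_prop)
    intro x hx
    simp only [mem_sphere_iff_norm, sub_zero, mem_ball_zero_iff] at hx hw ⊢
    intro h
    rw [sub_eq_zero.1 h] at hx
    linarith
  have key : ∀ w ∈ ball (0 : ℂ) r,
      F w = (Real.circleAverage (fun ζ => herglotzRieszKernel 0 w ζ • (F ζ : ℂ)) 0 r).re := by
    intro w hw
    have hFci : CircleIntegrable (fun ζ => herglotzRieszKernel 0 w ζ • (F ζ : ℂ)) 0 r := by
      apply ContinuousOn.circleIntegrable hr0.le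
      exact (hker w hw).smul (continuous_ofReal.comp_continuousOn (hFc.mono hsph))
    have e1 := reCLM.circleAverage_comp_comm hFci
    have hlim : Tendsto (fun n => f n w) atTop (𝓝 (F w)) :=
      (hF s hs1).tendsto_at (ball_subset_ball hrs.le hw)
    refine tendsto_nhds_unique hlim ?_
    have hP : ∀ n, Real.circleAverage ((re ∘ herglotzRieszKernel 0 w) • f n) 0 r = f n w :=
      fun n => HarmonicOnNhd.circleAverage_re_herglotzRieszKernel_smul
        ((hf n).mono (closedBall_subset_ball hr1)) hw
    simp_rw [← hP]
    have e2 : (Real.circleAverage (fun ζ => herglotzRieszKernel 0 w ζ • (F ζ : ℂ)) 0 r).re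
        = Real.circleAverage ((re ∘ herglotzRieszKernel 0 w) • F) 0 r := by
      rw [← reCLM_apply, ← e1]
      congr 1
      ext ζ
      simp
    rw [e2]
    simp only [Real.circleAverage_def]
    apply Tendsto.const_smul
    obtain ⟨M, hM⟩ := (isCompact_sphere (0 : ℂ) r).exists_bound_of_continuousOn (hker w hw)
    have hunif := Metric.tendstoUniformlyOn_iff.1 (hF s hs1)
    obtain ⟨B, hB⟩ := (isCompact_sphere (0 : ℂ) r).exists_bound_of_continuousOn (hFc.mono hsph)
    have hmem : ∀ θ, circleMap 0 r θ ∈ sphere (0 : ℂ) r := fun θ =>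
      circleMap_mem_sphere 0 hr0.le θ
    apply intervalIntegral.tendsto_integral_filter_of_dominated_convergence
      (bound := fun _ => M * (B + 1))
    · refine Eventually.of_forall fun n => Continuous.aestronglyMeasurable ?_
      have : ContinuousOn ((re ∘ herglotzRieszKernel 0 w) • f n) (sphere 0 r) :=
        (continuous_re.comp_continuousOn (hker w hw)).smul
          ((hcontn n).mono (hsph.trans (ball_subset_ball hs1.le)))
      exact this.comp_continuous (continuous_circleMap 0 r) hmem
    · filter_upwards [hunif 1 one_pos] with n hn
      refine Eventually.of_forall fun θ _ => ?_
      have h1 := hn _ (hsph (hmem θ))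
      have h2 := hB _ (hmem θ)
      have h3 := hM _ (hmem θ)
      simp only [Pi.smul_apply', Function.comp_apply, smul_eq_mul, norm_mul]
      have h4 : ‖f n (circleMap 0 r θ)‖ ≤ B + 1 := by
        rw [dist_comm, dist_eq_norm] at h1
        have := norm_sub_norm_le (f n (circleMap 0 r θ)) (F (circleMap 0 r θ))
        linarith
      have h5 : ‖(herglotzRieszKernel 0 w (circleMap 0 r θ)).re‖ ≤ M :=
        (abs_re_le_norm _).trans h3
      exact mul_le_mul h5 h4 (norm_nonneg _) ((norm_nonneg _).trans h5)
    · exact intervalIntegrable_const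
    · refine Eventually.of_forall fun θ _ => ?_
      simp only [Pi.smul_apply', Function.comp_apply]
      exact ((hF s hs1).tendsto_at (hsph (hmem θ))).const_smul _
  have hFr : CircleIntegrable (fun ζ => (F ζ : ℂ)) 0 r :=
    (continuous_ofReal.comp_continuousOn (hFc.mono hsph)).circleIntegrable hr0.le
  have han := analyticOnNhd_circleAverage_herglotzRieszKernel_smul hFr z (by simpa using hzr)
  refine (harmonicAt_congr_nhds ?_).2 han.harmonicAt_re
  filter_upwards [isOpen_ball.mem_nhds (show z ∈ ball (0 : ℂ) r by simpa using hzr)] with w hw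
  exact key w hw

/-- A locally uniform limit of harmonic functions is harmonic (complex case). -/
theorem harmonicOnNhd_of_tendsto {f : ℕ → ℂ → ℂ} {F : ℂ → ℂ}
    (hf : ∀ n, HarmonicOnNhd (f n) (ball 0 1))
    (hF : ∀ r < 1, TendstoUniformlyOn f F atTop (ball 0 r)) :
    HarmonicOnNhd F (ball 0 1) := by
  have hre : HarmonicOnNhd (fun z => (F z).re) (ball 0 1) :=
    harmonicOnNhd_of_tendsto_real (f := fun n z => (f n z).re)
      (fun n => (hf n).comp_CLM reCLM)
      (fun r hr => reCLM.uniformContinuous.comp_tendstoUniformlyOn (hF r hr))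
  have him : HarmonicOnNhd (fun z => (F z).im) (ball 0 1) :=
    harmonicOnNhd_of_tendsto_real (f := fun n z => (f n z).im)
      (fun n => (hf n).comp_CLM imCLM)
      (fun r hr => imCLM.uniformContinuous.comp_tendstoUniformlyOn (hF r hr))
  have h1 := hre.comp_CLM ofRealCLM
  have h2 := him.comp_CLM (((ContinuousLinearMap.mul ℂ ℂ I).restrictScalars ℝ).comp ofRealCLM)
  have h3 := h1.add h2
  convert h3 using 1
  ext z
  simp [mul_comm I, re_add_im]

/-- The sub-mean value inequality on disks for the modulus of a harmonic function. -/
theorem enorm_le_lintegral_ball {f : ℂ → ℂ} {z : ℂ} {δ : ℝ} (hf : HarmonicOnNhd f (ball z δ)) :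
    (∫⁻ r in Ioo 0 δ, ENNReal.ofReal r) * ‖f z‖ₑ ≤ ∫⁻ w in ball z δ, ‖f w‖ₑ := by
  have hcont : ContinuousOn f (ball z δ) := hf.continuousOn
  have h0 : Measurable ((ball z δ).indicator fun w => ‖f w‖ₑ) := by
    classical
    have h := (hcont.measurable_piecewise (g := fun _ => (0 : ℂ)) continuousOn_const
      measurableSet_ball).enorm
    convert h using 1
    ext w
    by_cases hw : w ∈ ball z δ <;> simp [Set.piecewise, indicator, hw]
  set g : ℂ → ℝ≥0∞ := fun w => (ball z δ).indicator (fun w => ‖f w‖ₑ) (z + w) with hg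
  have hgm : Measurable g := h0.comp (measurable_const_add z)
  have hpm : Measurable fun p : ℝ × ℝ => (p.1 : ℂ) * (Real.cos p.2 + Real.sin p.2 * I) := by
    fun_prop
  have e1 : ∫⁻ w in ball z δ, ‖f w‖ₑ = ∫⁻ r in Ioi (0 : ℝ), ∫⁻ θ in Ioo (-π) π,
      ENNReal.ofReal r * g (r * (Real.cos θ + Real.sin θ * I)) := by
    rw [← lintegral_indicator measurableSet_ball, ← lintegral_add_left_eq_self _ z,
      ← Complex.lintegral_comp_polarCoord_symm, polarCoord_target, Measure.volume_eq_prod,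
      ← Measure.prod_restrict, lintegral_prod]
    · simp [hg]
    · simp only [Complex.polarCoord_symm_apply, smul_eq_mul]
      exact ((by fun_prop : Measurable fun p : ℝ × ℝ => ENNReal.ofReal p.1).mul
        (hgm.comp hpm)).aemeasurable
  rw [e1, ← lintegral_mul_const _ (by fun_prop)]
  have hss : Ioo (0 : ℝ) δ ⊆ Ioi 0 := Ioo_subset_Ioi_self
  refine le_trans ?_ (lintegral_mono_set hss)
  refine setLIntegral_mono' measurableSet_Ioo fun r hr => ?_
  have hcirc : ∀ θ : ℝ, z + r * (Real.cos θ + Real.sin θ * I) = circleMap z r θ := by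
    intro θ
    simp [circleMap, exp_mul_I]
  have hmem : ∀ θ : ℝ, circleMap z r θ ∈ ball z δ := fun θ => by
    rw [mem_ball, dist_eq_norm, circleMap_sub_center, norm_circleMap_zero, abs_of_pos hr.1]
    exact hr.2
  have hgm' : Measurable fun θ : ℝ => g (r * (Real.cos θ + Real.sin θ * I)) :=
    hgm.comp (by fun_prop)
  rw [lintegral_const_mul _ hgm']
  gcongr
  have hmean : Real.circleAverage f z r = f z := by
    apply InnerProductSpace.HarmonicOnNhd.circleAverage_eq
    rw [abs_of_pos hr.1]
    exact hf.mono (closedBall_subset_ball hr.2)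
  have hper : (2 * π)⁻¹ • ∫ θ in (-π)..π, f (circleMap z r θ) = f z := by
    rw [← hmean, Real.circleAverage_def]
    have hp : Function.Periodic (fun θ => f (circleMap z r θ)) (2 * π) :=
      (periodic_circleMap z r).comp f
    have := hp.intervalIntegral_add_eq (-π) 0
    rw [zero_add, show -π + 2 * π = π by ring] at this
    rw [this]
  have h2 : ‖∫ θ in (-π)..π, f (circleMap z r θ)‖ₑ
      ≤ ∫⁻ θ in Ioo (-π) π, g (r * (Real.cos θ + Real.sin θ * I)) := by
    rw [intervalIntegral.integral_of_le (by linarith [Real.pi_pos]), integral_Ioc_eq_integral_Ioo]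
    refine (enorm_integral_le_lintegral_enorm _).trans (lintegral_mono fun θ => ?_)
    simp only [hg]
    rw [hcirc, indicator_of_mem (hmem θ)]
  refine le_trans ?_ h2
  rw [← hper, enorm_smul]
  refine mul_le_of_le_one_left zero_le ?_
  rw [Real.enorm_eq_ofReal (by positivity)]
  rw [ENNReal.ofReal_le_one]
  exact inv_le_one_of_one_le₀ (by linarith [Real.pi_gt_three])

/-- The area measure of the disk is finite. -/
instance : IsFiniteMeasure diskMeasure := by
  unfold diskMeasure
  have : IsFiniteMeasure (volume.restrict (ball (0 : ℂ) 1)) :=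
    isFiniteMeasure_restrict.2 measure_ball_lt_top.ne
  refine ⟨?_⟩
  rw [Measure.smul_apply, smul_eq_mul]
  exact ENNReal.mul_lt_top (by simp [Real.pi_pos]) (measure_lt_top _ _)

theorem ae_restrict_iff_ae_diskMeasure {P : ℂ → Prop} :
    (∀ᵐ z ∂diskMeasure, P z) ↔ ∀ᵐ z ∂volume.restrict (ball (0 : ℂ) 1), P z := by
  unfold diskMeasure
  simp only [ae_iff, Measure.smul_apply, smul_eq_mul]
  simp

/-- Point evaluations are bounded on `L²_h`, uniformly on smaller disks. -/
theorem norm_le_of_mem_ball {r : ℝ} (hr : r < 1) : ∃ K : ℝ, ∀ (u : L2Disk) (f : ℂ → ℂ),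
    HarmonicOnNhd f (ball 0 1) → u =ᵐ[diskMeasure] f → ∀ z ∈ ball (0 : ℂ) r,
    ‖f z‖ ≤ K * ‖u‖ := by
  set c : ℝ≥0∞ := ∫⁻ t in Ioo 0 (1 - r), ENNReal.ofReal t with hc
  have hc0 : c ≠ 0 := by
    rw [hc, ← pos_iff_ne_zero, setLIntegral_pos_iff (by fun_prop)]
    have : Ioo 0 (1 - r) ⊆ Function.support (fun t => ENNReal.ofReal t) ∩ Ioo 0 (1 - r) :=
      fun t ht => ⟨by simpa using ht.1, ht⟩
    refine lt_of_lt_of_le ?_ (measure_mono this)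
    simp [hr]
  set D : ℝ≥0∞ := ENNReal.ofReal π * diskMeasure univ ^ (1 / (1 : ℝ≥0∞).toReal -
    1 / (2 : ℝ≥0∞).toReal) with hD
  have hDt : D ≠ ∞ := by
    refine ENNReal.mul_ne_top ENNReal.ofReal_ne_top (ENNReal.rpow_ne_top_of_nonneg ?_ ?_)
    · norm_num
    · exact measure_ne_top _ _
  refine ⟨(c⁻¹ * D).toReal, fun u f hf huf z hz => ?_⟩
  have hsub : ball z (1 - r) ⊆ ball 0 1 := by
    apply ball_subset_ball'
    have := mem_ball.1 hz
    linarith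
  have h1 := enorm_le_lintegral_ball (hf.mono hsub)
  have h2 : ∫⁻ w in ball z (1 - r), ‖f w‖ₑ ≤ D * ‖u‖ₑ := by
    calc ∫⁻ w in ball z (1 - r), ‖f w‖ₑ ≤ ∫⁻ w in ball 0 1, ‖f w‖ₑ := lintegral_mono_set hsub
      _ = ENNReal.ofReal π * ∫⁻ w, ‖f w‖ₑ ∂diskMeasure := by
          rw [diskMeasure, lintegral_smul_measure, smul_eq_mul, ← mul_assoc,
            ENNReal.mul_inv_cancel (by simp [Real.pi_pos]) (by simp), one_mul]
      _ = ENNReal.ofReal π * eLpNorm u 1 diskMeasure := by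
          rw [eLpNorm_congr_ae huf, eLpNorm_one_eq_lintegral_enorm]
      _ ≤ ENNReal.ofReal π * (eLpNorm u 2 diskMeasure * diskMeasure univ ^
            (1 / (1 : ℝ≥0∞).toReal - 1 / (2 : ℝ≥0∞).toReal)) := by
          gcongr
          exact eLpNorm_le_eLpNorm_mul_rpow_measure_univ (by norm_num)
            (Lp.aestronglyMeasurable u)
      _ = D * ‖u‖ₑ := by rw [Lp.enorm_def, hD]; ring
  have hct : c ≠ ∞ := by
    have := setLIntegral_lt_top_of_le_nnreal (μ := volume) (s := Ioo (0 : ℝ) (1 - r))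
      (f := fun t => ENNReal.ofReal t) (by simp)
      ⟨(1 - r).toNNReal, fun t ht => ENNReal.ofReal_le_ofReal ht.2.le⟩
    exact this.ne
  have h3 : ‖f z‖ₑ ≤ c⁻¹ * D * ‖u‖ₑ := by
    rw [mul_assoc, ← ENNReal.div_eq_inv_mul, ENNReal.le_div_iff_mul_le (Or.inl hc0) (Or.inl hct),
      mul_comm]
    exact h1.trans h2
  have hfin : c⁻¹ * D ≠ ∞ := ENNReal.mul_ne_top (ENNReal.inv_ne_top.2 hc0) hDt
  have h4 := ENNReal.toReal_mono (ENNReal.mul_ne_top hfin enorm_ne_top) h3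
  rwa [ENNReal.toReal_mul, toReal_enorm, toReal_enorm] at h4

/-- `L²_h` is a closed subspace of `L²(𝔻, dA)`. -/
theorem isClosed_harmonicBergman : IsClosed (harmonicBergman : Set L2Disk) := by
  apply IsSeqClosed.isClosed
  intro u v hu huv
  choose f hf huf using hu
  have hunif : ∀ r < 1, UniformCauchySeqOn f atTop (ball 0 r) := by
    intro r hr
    obtain ⟨K, hK⟩ := norm_le_of_mem_ball hr
    have hdiff : ∀ m n, ∀ z ∈ ball (0 : ℂ) r, ‖f m z - f n z‖ ≤ K * ‖u m - u n‖ := by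
      intro m n z hz
      exact hK (u m - u n) (f m - f n) ((hf m).sub (hf n))
        ((Lp.coeFn_sub _ _).trans ((huf m).sub (huf n))) z hz
    rw [Metric.uniformCauchySeqOn_iff]
    intro ε hε
    obtain ⟨N, hN⟩ := Metric.cauchySeq_iff.1 huv.cauchySeq (ε / (|K| + 1)) (by positivity)
    refine ⟨N, fun m hm n hn z hz => ?_⟩
    rw [dist_eq_norm]
    have h1 := hN m hm n hn
    rw [dist_eq_norm, lt_div_iff₀ (by positivity)] at h1
    refine (hdiff m n z hz).trans_lt (lt_of_le_of_lt ?_ h1)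
    have := le_abs_self K
    nlinarith [norm_nonneg (u m - u n)]
  have hpt : ∀ z : ℂ, ∃ L : ℂ, z ∈ ball (0 : ℂ) 1 → Tendsto (fun n => f n z) atTop (𝓝 L) := by
    intro z
    by_cases hz : z ∈ ball (0 : ℂ) 1
    · obtain ⟨r, hzr, hr1⟩ := exists_between (show ‖z‖ < 1 by simpa using hz)
      obtain ⟨L, hL⟩ := cauchySeq_tendsto_of_complete
        ((hunif r hr1).cauchySeq (x := z) (by simpa using hzr))
      exact ⟨L, fun _ => hL⟩
    · exact ⟨0, fun h => absurd h hz⟩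
  choose F hF using hpt
  refine ⟨F, harmonicOnNhd_of_tendsto hf fun r hr => ?_, ?_⟩
  · exact (hunif r hr).tendstoUniformlyOn_of_tendsto fun z hz => hF z (ball_subset_ball hr.le hz)
  · obtain ⟨ns, hns, hae⟩ := (tendstoInMeasure_of_tendsto_Lp huv).exists_seq_tendsto_ae
    have hball : ∀ᵐ z ∂diskMeasure, z ∈ ball (0 : ℂ) 1 :=
      ae_restrict_iff_ae_diskMeasure.2 (ae_restrict_mem measurableSet_ball)
    filter_upwards [hae, hball, ae_all_iff.2 huf] with z hz hzb hzf
    refine tendsto_nhds_unique hz ?_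
    simp_rw [hzf]
    exact (hF z hzb).comp hns.tendsto_atTop

instance : CompleteSpace harmonicBergman := isClosed_harmonicBergman.completeSpace_coe

/-! ### Toeplitz operators -/

/-- The Toeplitz operator `T_f u = Q (f u)` on `L²_h` with bounded symbol `f`, where `Q` is the
orthogonal projection of `L²(𝔻, dA)` onto `L²_h`. -/
def toeplitz (f : LinftyDisk) : harmonicBergman →L[ℂ] harmonicBergman :=
  harmonicBergman.orthogonalProjectionOnto ∘L
    ((ContinuousLinearMap.mul ℂ ℂ).holderL diskMeasure ∞ 2 2 f) ∘L harmonicBergman.subtypeL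

/-- A bounded operator on `L²_h` is a Toeplitz operator if it is `T_f` for some bounded `f`. -/
def IsToeplitz (A : harmonicBergman →L[ℂ] harmonicBergman) : Prop :=
  ∃ f : LinftyDisk, A = toeplitz f

/-! ### Quasihomogeneous and radial symbols -/

/-- The modulus maps the disk measure to a measure which is absolutely continuous on `(0, 1)`. -/
theorem quasiMeasurePreserving_norm : Measure.QuasiMeasurePreserving (fun z : ℂ => ‖z‖)
    diskMeasure (volume.restrict (Ioo (0 : ℝ) 1)) := by
  refine ⟨measurable_norm, ?_⟩
  refine Measure.AbsolutelyContinuous.mk fun s hs h0 => ?_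
  rw [Measure.restrict_apply hs] at h0
  rw [Measure.map_apply measurable_norm hs, measure_eq_zero_iff_ae_notMem,
    ae_restrict_iff_ae_diskMeasure, ae_restrict_iff' measurableSet_ball, ae_iff]
  set A : Set ℂ := {z | ¬(z ∈ ball (0 : ℂ) 1 → z ∉ (fun z : ℂ => ‖z‖) ⁻¹' s)} with hA
  have hAeq : A = ball (0 : ℂ) 1 ∩ (fun z : ℂ => ‖z‖) ⁻¹' s := by
    ext z
    simp [hA]
  have hAm : MeasurableSet A := hAeq ▸ measurableSet_ball.inter (measurable_norm hs)
  rw [← lintegral_indicator_one hAm, ← Complex.lintegral_comp_polarCoord_symm,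
    polarCoord_target, Measure.volume_eq_prod, ← Measure.prod_restrict]
  rw [← nonpos_iff_eq_zero, ← lintegral_zero]
  refine lintegral_mono_ae ?_
  have h1 : ∀ᵐ r : ℝ ∂volume.restrict (Ioi (0 : ℝ)), r ∈ Ioi (0 : ℝ) ∧ r ∉ s ∩ Ioo 0 1 :=
    (ae_restrict_mem measurableSet_Ioi).and
      (ae_restrict_of_ae (measure_eq_zero_iff_ae_notMem.1 h0))
  filter_upwards [Measure.quasiMeasurePreserving_fst.ae h1] with p hp
  have hpA : Complex.polarCoord.symm p ∉ A := by
    rw [hAeq]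
    rintro ⟨h2, h3⟩
    rw [mem_ball_zero_iff, norm_polarCoord_symm, abs_of_pos hp.1] at h2
    rw [mem_preimage, norm_polarCoord_symm, abs_of_pos hp.1] at h3
    exact hp.2 ⟨h3, hp.1, h2⟩
  rw [indicator_of_notMem hpA]
  simp

/-- The function `r e^{iθ} ↦ e^{ipθ} φ(r)`. -/
def quasihomogeneous (p : ℤ) (φ : ℝ → ℂ) (z : ℂ) : ℂ :=
  exp (I * p * arg z) * φ ‖z‖

theorem memLp_quasihomogeneous (p : ℤ) {φ : ℝ → ℂ}
    (hφ : MemLp φ ∞ (volume.restrict (Ioo (0 : ℝ) 1))) :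
    MemLp (quasihomogeneous p φ) ∞ diskMeasure := by
  have h1 : MemLp (fun z : ℂ => φ ‖z‖) ∞ diskMeasure := by
    have hb : ∀ᵐ r ∂volume.restrict (Ioo (0 : ℝ) 1),
        ‖φ r‖ ≤ (eLpNormEssSup φ (volume.restrict (Ioo (0 : ℝ) 1))).toReal := by
      filter_upwards [ae_le_eLpNormEssSup (f := φ)] with r hr
      have hfin : eLpNormEssSup φ (volume.restrict (Ioo (0 : ℝ) 1)) ≠ ∞ := by
        rw [← eLpNorm_exponent_top]
        exact hφ.2.ne
      simpa using ENNReal.toReal_mono hfin hr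
    exact memLp_top_of_bound (hφ.1.comp_quasiMeasurePreserving quasiMeasurePreserving_norm) _
      (quasiMeasurePreserving_norm.ae hb)
  have h2 : AEStronglyMeasurable (quasihomogeneous p φ) diskMeasure :=
    (Measurable.aestronglyMeasurable (by fun_prop : Measurable fun z : ℂ =>
      exp (I * p * arg z))).mul h1.1
  refine h1.of_le h2 (Eventually.of_forall fun z => ?_)
  have h3 : ‖exp (I * p * arg z)‖ = 1 := by
    rw [show I * p * arg z = ((p * arg z : ℝ) : ℂ) * I by push_cast; ring]
    exact norm_exp_ofReal_mul_I _
  rw [quasihomogeneous, norm_mul, h3, one_mul]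

theorem memLp_radial {ψ : ℝ → ℂ} (hψ : MemLp ψ ∞ (volume.restrict (Ioo (0 : ℝ) 1))) :
    MemLp (fun z : ℂ => ψ ‖z‖) ∞ diskMeasure := by
  have h : quasihomogeneous 0 ψ = fun z : ℂ => ψ ‖z‖ := by
    ext z
    simp [quasihomogeneous]
  exact h ▸ memLp_quasihomogeneous 0 hψ

/-- The quasihomogeneous symbol `e^{ipθ} φ` of order `p`, for a bounded radial function `φ`. -/
def quasihomogeneousSymbol (p : ℤ) (φ : ℝ → ℂ)
    (hφ : MemLp φ ∞ (volume.restrict (Ioo (0 : ℝ) 1))) : LinftyDisk :=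
  (memLp_quasihomogeneous p hφ).toLp (quasihomogeneous p φ)

/-- The radial symbol `z ↦ ψ(|z|)`, for a bounded function `ψ` on `(0, 1)`. -/
def radialSymbol (ψ : ℝ → ℂ)
    (hψ : MemLp ψ ∞ (volume.restrict (Ioo (0 : ℝ) 1))) : LinftyDisk :=
  (memLp_radial hψ).toLp fun z : ℂ => ψ ‖z‖

/-- The Mellin transform `∫₀¹ φ(r) r^{z-1} dr` of a radial function. -/
def radialMellin (φ : ℝ → ℂ) (z : ℂ) : ℂ :=
  ∫ r in (0 : ℝ)..1, φ r * (r : ℂ) ^ (z - 1)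

end

end HarmonicBergman

namespace HarmonicBergman

open MeasureTheory Complex Metric Set Filter Topology InnerProductSpace
open scoped ENNReal Real ComplexConjugate

noncomputable section

/-! ### Integration in polar coordinates -/

/-! Write e_n for r^{|n|} e^{inθ}. The radial operator T_ψ is diagonal in these monomials, with
eigenvalue λ_{|n|} = (2|n|+2) ψ̂(2|n|+2) on e_n. Hence the coefficient of the product between e_n
and e_{p+n} is 2 λ_{|n|} φ̂(|n|+|p+n|+2). If the product is T_f, the same coefficient is the
integral of f e^{-ipθ} r^{|n|+|p+n|}, which sees n only through s(n) = |n|+|p+n|. Since φ̂ does not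
vanish at the relevant points, s(m) = s(n) forces λ_{|m|} = λ_{|n|}
(`radialEigenvalue_eq_of_isToeplitz`).

The level sets of s now do the work. On the integers between 0 and -p, s is constantly |p|, so λ_0,
..., λ_{|p|} agree. Beyond them, the reflection n ↦ -p-n preserves s and exchanges moduli i and
i+|p|, so λ_{i+|p|} = λ_i. As p is nonzero, every λ_k equals λ_0 =: c. Then ψ - c is orthogonal to
all r^{2k} with respect to r dr, and Weierstrass approximation in r² gives ψ = c almost everywhere
(`ae_eq_const_of_radialEigenvalue_eq`).

The analytic input is that the n-th Fourier coefficient of a harmonic function on the circle of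
radius r is a constant times r^{|n|} (`exists_hasFourierCoeff`). It allows the eigenvector equation
to be tested against every element of L²_h, so completeness of the monomials is not needed. -/

theorem integrable_diskMeasure_iff {G : ℂ → ℂ} :
    Integrable G diskMeasure ↔ IntegrableOn G (ball 0 1) := by
  unfold diskMeasure
  rw [integrable_smul_measure (by simp) (by simp [Real.pi_pos]), IntegrableOn]

/-- Supplies the integrability that Fubini requires in `integral_diskMeasure`; the weight is the
Jacobian r. -/
theorem integrableOn_polarCoord_target {G : ℂ → ℂ} (hG : Integrable G) :
    IntegrableOn (fun q : ℝ × ℝ => q.1 • G (Complex.polarCoord.symm q)) polarCoord.target := by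
  have h1 : Integrable (fun q : ℝ × ℝ => G (measurableEquivRealProd.symm q)) :=
    (Complex.volume_preserving_equiv_real_prod.symm).integrable_comp_of_integrable hG
  have h2 := (integrableOn_image_iff_integrableOn_abs_det_fderiv_smul volume
    polarCoord.open_target.measurableSet
    (fun q _ => (hasFDerivAt_polarCoord_symm q).hasFDerivWithinAt) polarCoord.symm.injOn
    (fun q : ℝ × ℝ => G (measurableEquivRealProd.symm q))).1 h1.integrableOn
  refine h2.congr_fun (fun q hq => ?_) polarCoord.open_target.measurableSet
  simp only [det_fderivPolarCoordSymm]
  rw [measurableEquivRealProd_symm_polarCoord_symm_apply, abs_of_pos hq.1]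

theorem polarCoord_symm_eq_circleMap (r θ : ℝ) :
    Complex.polarCoord.symm (r, θ) = circleMap 0 r θ := by
  simp [circleMap, exp_mul_I]

/-- The angle runs over (-π, π] to match the branch of `arg` in `quasihomogeneous`. -/
theorem integral_diskMeasure {G : ℂ → ℂ} (hG : Integrable G diskMeasure) :
    ∫ z, G z ∂diskMeasure =
      (π : ℂ)⁻¹ * ∫ r in (0 : ℝ)..1, r * ∫ θ in (-π)..π, G (circleMap 0 r θ) := by
  have h1 : Integrable ((ball (0 : ℂ) 1).indicator G) :=
    (integrable_diskMeasure_iff.1 hG).integrable_indicator measurableSet_ball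
  have h2 := integrableOn_polarCoord_target h1
  rw [diskMeasure, integral_smul_measure, ← integral_indicator measurableSet_ball,
    ← Complex.integral_comp_polarCoord_symm]
  rw [polarCoord_target, Measure.volume_eq_prod] at h2 ⊢
  rw [setIntegral_prod _ h2, intervalIntegral.integral_of_le zero_le_one,
    integral_Ioc_eq_integral_Ioo, ENNReal.toReal_inv, ENNReal.toReal_ofReal Real.pi_pos.le,
    Complex.real_smul, ofReal_inv]
  congr 1
  have hss : Ioo (0 : ℝ) 1 ⊆ Ioi 0 := Ioo_subset_Ioi_self
  rw [setIntegral_eq_of_subset_of_forall_sdiff_eq_zero (s := Ioo (0 : ℝ) 1) (t := Ioi 0)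
    measurableSet_Ioi hss]
  · refine setIntegral_congr_fun measurableSet_Ioo fun r hr => ?_
    simp only
    rw [intervalIntegral.integral_of_le (by linarith [Real.pi_pos]), integral_Ioc_eq_integral_Ioo,
      ← integral_const_mul]
    symm
    refine setIntegral_congr_fun measurableSet_Ioo fun θ _ => ?_
    rw [polarCoord_symm_eq_circleMap, indicator_of_mem, Complex.real_smul]
    rw [mem_ball_zero_iff, norm_circleMap_zero, abs_of_pos hr.1]
    exact hr.2
  · intro r hr
    refine setIntegral_eq_zero_of_forall_eq_zero fun θ _ => ?_
    rw [polarCoord_symm_eq_circleMap, indicator_of_notMem, smul_zero]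
    rw [mem_ball_zero_iff, norm_circleMap_zero, abs_of_pos hr.1]
    exact fun h => hr.2 ⟨hr.1, h⟩

theorem quasihomogeneous_circleMap (n : ℤ) (Φ : ℝ → ℂ) {r θ : ℝ} (hr : 0 < r)
    (hθ : θ ∈ Ioc (-π) π) :
    quasihomogeneous n Φ (circleMap 0 r θ) = exp (n * θ * I) * Φ r := by
  have h : arg (circleMap 0 r θ) = θ := by
    rw [circleMap_zero, exp_mul_I, arg_mul_cos_add_sin_mul_I hr hθ]
  rw [quasihomogeneous, h, norm_circleMap_zero, abs_of_pos hr]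
  ring_nf

theorem quasihomogeneous_mul (m n : ℤ) (Φ Ψ : ℝ → ℂ) (z : ℂ) :
    quasihomogeneous m Φ z * quasihomogeneous n Ψ z = quasihomogeneous (m + n) (Φ * Ψ) z := by
  simp only [quasihomogeneous, Pi.mul_apply]
  rw [show I * ((m + n : ℤ) : ℂ) * arg z = I * m * arg z + I * n * arg z by push_cast; ring,
    exp_add]
  ring

/-! ### Fourier coefficients of harmonic functions on circles -/

/-- The `n`-th Fourier coefficient of `h` on the circle of radius `r` is `c r^{|n|} / 2π`. -/
def HasFourierCoeff (h : ℂ → ℂ) (n : ℤ) (c : ℂ) : Prop :=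
  ∀ r ∈ Ioo (0 : ℝ) 1,
    ∫ θ in (-π)..π, h (circleMap 0 r θ) * exp (-(n * θ * I)) = c * (r : ℂ) ^ n.natAbs

theorem exp_int_mul_periodic (n : ℤ) :
    Function.Periodic (fun θ : ℝ => exp (-(n * θ * I))) (2 * π) := by
  intro θ
  simp only
  have : -((n : ℂ) * ((θ + 2 * π : ℝ) : ℂ) * I)
      = -(n * θ * I) + ((-n : ℤ) : ℂ) * (2 * π * I) := by
    push_cast; ring
  rw [this, exp_add, exp_int_mul_two_pi_mul_I, mul_one]

/-- Periodicity links the range adapted to `arg` with the one used by circle integrals. -/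
theorem integral_symm_eq (h : ℂ → ℂ) (n : ℤ) (r : ℝ) :
    ∫ θ in (-π)..π, h (circleMap 0 r θ) * exp (-(n * θ * I)) =
      ∫ θ in (0 : ℝ)..2 * π, h (circleMap 0 r θ) * exp (-(n * θ * I)) := by
  have hp : Function.Periodic (fun θ : ℝ => h (circleMap 0 r θ) * exp (-(n * θ * I))) (2 * π) :=
    ((periodic_circleMap 0 r).comp h).mul (exp_int_mul_periodic n)
  have := hp.intervalIntegral_add_eq (-π) 0
  rwa [zero_add, show -π + 2 * π = π by ring] at this

/-- On the circle dz = iz dθ, which accounts for I⁻¹ and for the extra -1 in the exponent. -/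
theorem integral_eq_circleIntegral (F : ℂ → ℂ) (n : ℤ) {r : ℝ} (hr : 0 < r) :
    ∫ θ in (0 : ℝ)..2 * π, F (circleMap 0 r θ) * exp (-(n * θ * I)) =
      (r : ℂ) ^ n * (I⁻¹ * ∮ z in C(0, r), F z * z ^ (-n - 1)) := by
  have hr' : (r : ℂ) ≠ 0 := by exact_mod_cast hr.ne'
  rw [circleIntegral_def_Icc, integral_Icc_eq_integral_Ioc,
    ← intervalIntegral.integral_of_le (by positivity), ← intervalIntegral.integral_const_mul,
    ← intervalIntegral.integral_const_mul]
  congr 1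
  ext θ
  have h0 : circleMap 0 r θ ≠ 0 := circleMap_ne_center hr.ne'
  have h1 : circleMap 0 r θ ^ (-n) = (r : ℂ) ^ (-n) * exp (-(n * θ * I)) := by
    rw [circleMap_zero, mul_zpow, ← exp_int_mul]
    congr 2
    push_cast; ring
  have h2 : (r : ℂ) ^ n * (r : ℂ) ^ (-n) = 1 := by
    rw [← zpow_add₀ hr', add_neg_cancel, zpow_zero]
  rw [zpow_sub_one₀ h0, h1, deriv_circleMap, smul_eq_mul]
  field_simp
  linear_combination (-F (circleMap 0 r θ)) * h2

/-- For n ≥ 0, Cauchy's theorem on annuli makes the circle integral of F z^{-n-1} independent of the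
radius. For n < 0 the exponent -n-1 is nonnegative, the integrand is holomorphic in the disk, and
the coefficient is 0. -/
theorem exists_hasFourierCoeff_of_analytic {F : ℂ → ℂ} (hF : AnalyticOnNhd ℂ F (ball 0 1))
    (n : ℤ) : ∃ c, HasFourierCoeff F n c := by
  have hd : ∀ z ∈ ball (0 : ℂ) 1, DifferentiableAt ℂ F z := fun z hz => (hF z hz).differentiableAt
  rcases le_or_gt 0 n with hn | hn
  · have key : ∀ r ∈ Ioo (0 : ℝ) 1, ∀ R ∈ Ioo (0 : ℝ) 1, r ≤ R →
        ∮ z in C(0, R), F z * z ^ (-n - 1) = ∮ z in C(0, r), F z * z ^ (-n - 1) := by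
      intro r hr R hR hrR
      have hdd : ∀ z ∈ closedBall (0 : ℂ) R \ ball 0 r,
          DifferentiableAt ℂ (fun z => F z * z ^ (-n - 1)) z := by
        intro z hz
        have hz1 : ‖z‖ ≤ R := by simpa using hz.1
        have hz2 : r ≤ ‖z‖ := by simpa using hz.2
        refine (hd z ?_).mul (differentiableAt_zpow.2 (Or.inl ?_))
        · simpa using hz1.trans_lt hR.2
        · exact norm_pos_iff.1 (hr.1.trans_le hz2)
      refine circleIntegral_eq_of_differentiable_on_annulus_off_countable hr.1 hrR
        countable_empty (fun z hz => (hdd z hz).continuousAt.continuousWithinAt) fun z hz => ?_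
      exact hdd z ⟨ball_subset_closedBall hz.1.1, fun h => hz.1.2 (ball_subset_closedBall h)⟩
    -- An arbitrary reference radius, at which the constant is computed.
    have half : (1 / 2 : ℝ) ∈ Ioo (0 : ℝ) 1 := by norm_num
    refine ⟨I⁻¹ * ∮ z in C(0, 1 / 2), F z * z ^ (-n - 1), fun r hr => ?_⟩
    rw [integral_symm_eq, integral_eq_circleIntegral F n hr.1]
    have : ∮ z in C(0, r), F z * z ^ (-n - 1) = ∮ z in C(0, 1 / 2), F z * z ^ (-n - 1) := by
      rcases le_total r (1 / 2) with h | h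
      · exact (key r hr _ half h).symm
      · exact key _ half r hr h
    rw [this, mul_comm, ← zpow_natCast, Int.natAbs_of_nonneg hn]
  · refine ⟨0, fun r hr => ?_⟩
    rw [integral_symm_eq, integral_eq_circleIntegral F n hr.1, zero_mul]
    have hdd : ∀ z ∈ closedBall (0 : ℂ) r,
        DifferentiableAt ℂ (fun z => F z * z ^ (-n - 1)) z := by
      intro z hz
      refine (hd z ?_).mul (differentiableAt_zpow.2 (Or.inr (by omega)))
      exact closedBall_subset_ball hr.2 hz
    rw [circleIntegral_eq_zero_of_differentiable_on_off_countable hr.1.le countable_empty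
      (fun z hz => (hdd z hz).continuousAt.continuousWithinAt)
      fun z hz => hdd z (ball_subset_closedBall hz.1)]
    simp

theorem HasFourierCoeff.conj {h : ℂ → ℂ} {n : ℤ} {c : ℂ} (hc : HasFourierCoeff h (-n) c) :
    HasFourierCoeff (fun z => conj (h z)) n (conj c) := by
  intro r hr
  have hle : -π ≤ π := by linarith [Real.pi_pos]
  have h1 := congrArg conj (hc r hr)
  rw [intervalIntegral.integral_of_le hle, ← integral_conj, map_mul, map_pow, conj_ofReal,
    Int.natAbs_neg] at h1
  rw [← h1, intervalIntegral.integral_of_le hle]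
  congr 1
  ext θ
  rw [map_mul, ← exp_conj]
  simp

theorem HasFourierCoeff.add {f g : ℂ → ℂ} {n : ℤ} {c d : ℂ} (hf : HasFourierCoeff f n c)
    (hg : HasFourierCoeff g n d) (hfc : ContinuousOn f (ball 0 1))
    (hgc : ContinuousOn g (ball 0 1)) : HasFourierCoeff (fun z => f z + g z) n (c + d) := by
  intro r hr
  have hmem : ∀ θ, circleMap 0 r θ ∈ ball (0 : ℂ) 1 := fun θ => by
    rw [mem_ball_zero_iff, norm_circleMap_zero, abs_of_pos hr.1]
    exact hr.2
  have hint : ∀ k : ℂ → ℂ, ContinuousOn k (ball 0 1) → IntervalIntegrable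
      (fun θ : ℝ => k (circleMap 0 r θ) * exp (-(n * θ * I))) volume (-π) π := fun k hk =>
    ((hk.comp_continuous (continuous_circleMap 0 r) hmem).mul (by fun_prop)).intervalIntegrable _ _
  simp only [add_mul]
  rw [intervalIntegral.integral_add (hint f hfc) (hint g hgc), hf r hr, hg r hr]

theorem HasFourierCoeff.const_mul {f : ℂ → ℂ} {n : ℤ} {c : ℂ} (hf : HasFourierCoeff f n c)
    (a : ℂ) : HasFourierCoeff (fun z => a * f z) n (a * c) := by
  intro r hr
  simp only [mul_assoc a]
  rw [intervalIntegral.integral_const_mul, hf r hr]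

theorem HasFourierCoeff.congr {f g : ℂ → ℂ} {n : ℤ} {c : ℂ} (hf : HasFourierCoeff f n c)
    (hfg : EqOn f g (ball 0 1)) : HasFourierCoeff g n c := by
  intro r hr
  rw [← hf r hr]
  congr 1
  ext θ
  rw [hfg]
  rw [mem_ball_zero_iff, norm_circleMap_zero, abs_of_pos hr.1]
  exact hr.2

/-- On the disk u = (F + conj F)/2 with F analytic; the conjugate contributes through the
coefficient of F of order -n. -/
theorem exists_hasFourierCoeff_of_harmonic_real {u : ℂ → ℝ} (hu : HarmonicOnNhd u (ball 0 1))
    (n : ℤ) : ∃ c, HasFourierCoeff (fun z => (u z : ℂ)) n c := by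
  obtain ⟨F, hF, hFu⟩ := hu.exists_analyticOnNhd_ball_re_eq
  obtain ⟨a, ha⟩ := exists_hasFourierCoeff_of_analytic hF n
  obtain ⟨b, hb⟩ := exists_hasFourierCoeff_of_analytic hF (-n)
  have hc : ContinuousOn F (ball 0 1) := hF.continuousOn
  refine ⟨_, ((ha.add hb.conj hc (continuous_conj.comp_continuousOn hc)).const_mul
    (1 / 2)).congr fun z hz => ?_⟩
  simp only
  rw [← hFu hz, re_eq_add_conj]
  ring

theorem exists_hasFourierCoeff {h : ℂ → ℂ} (hh : HarmonicOnNhd h (ball 0 1)) (n : ℤ) :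
    ∃ c, HasFourierCoeff h n c := by
  have h1 : HarmonicOnNhd (fun z => (h z).re) (ball 0 1) := hh.comp_CLM reCLM
  have h2 : HarmonicOnNhd (fun z => (h z).im) (ball 0 1) := hh.comp_CLM imCLM
  obtain ⟨a, ha⟩ := exists_hasFourierCoeff_of_harmonic_real h1 n
  obtain ⟨b, hb⟩ := exists_hasFourierCoeff_of_harmonic_real h2 n
  have hc1 := continuous_ofReal.comp_continuousOn h1.continuousOn
  have hc2 := continuous_ofReal.comp_continuousOn h2.continuousOn
  refine ⟨_, (ha.add (hb.const_mul I) hc1 (continuousOn_const.mul hc2)).congr fun z _ => ?_⟩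
  simp only
  rw [mul_comm I, re_add_im]

/-! ### The monomials `r^{|n|} e^{inθ}` -/

/-- The radial function `r ↦ r^N`. -/
def radialPow (N : ℕ) (r : ℝ) : ℂ := (r : ℂ) ^ N

theorem memLp_radialPow (N : ℕ) : MemLp (radialPow N) ∞ (volume.restrict (Ioo (0 : ℝ) 1)) := by
  refine memLp_top_of_bound (by unfold radialPow; fun_prop) 1 ?_
  filter_upwards [ae_restrict_mem measurableSet_Ioo] with r hr
  rw [radialPow, norm_pow, norm_real, Real.norm_eq_abs, abs_of_pos hr.1]
  exact pow_le_one₀ hr.1.le hr.2.le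

theorem memLp_two_quasihomogeneous (n : ℤ) {Φ : ℝ → ℂ}
    (hΦ : MemLp Φ ∞ (volume.restrict (Ioo (0 : ℝ) 1))) :
    MemLp (quasihomogeneous n Φ) 2 diskMeasure :=
  (memLp_quasihomogeneous n hΦ).mono_exponent le_top

theorem conj_quasihomogeneous (n : ℤ) (Φ : ℝ → ℂ) (z : ℂ) :
    conj (quasihomogeneous n Φ z) = quasihomogeneous (-n) (fun r => conj (Φ r)) z := by
  rw [quasihomogeneous, quasihomogeneous, map_mul, ← exp_conj]
  simp

theorem quasihomogeneous_radialPow_natCast (k : ℕ) (z : ℂ) :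
    quasihomogeneous k (radialPow k) z = z ^ k := by
  conv_rhs => rw [← norm_mul_exp_arg_mul_I z, mul_pow, ← exp_nat_mul]
  rw [quasihomogeneous, radialPow, mul_comm]
  congr 2
  push_cast
  ring

theorem harmonicOnNhd_monomial (n : ℤ) :
    HarmonicOnNhd (quasihomogeneous n (radialPow n.natAbs)) (ball 0 1) := by
  have h : ∀ k : ℕ, HarmonicOnNhd (fun z : ℂ => z ^ k) (ball 0 1) := fun k z _ =>
    (analyticAt_id.pow k).harmonicAt
  obtain ⟨k, rfl | rfl⟩ := n.eq_nat_or_neg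
  · rw [Int.natAbs_natCast, funext (quasihomogeneous_radialPow_natCast k)]
    exact h k
  · have e : quasihomogeneous (-(k : ℤ)) (radialPow (-(k : ℤ)).natAbs)
        = conjCLE ∘ fun z : ℂ => z ^ k := by
      ext z
      rw [Function.comp_apply, ← quasihomogeneous_radialPow_natCast, conjCLE_apply,
        conj_quasihomogeneous, Int.natAbs_neg, Int.natAbs_natCast]
      congr 1
      ext r
      simp [radialPow]
    rw [e]
    exact (h k).comp_CLM conjCLE.toContinuousLinearMap

/-- The function `r^{|n|} e^{inθ}` as an element of `L²_h`. -/
def monomial (n : ℤ) : harmonicBergman :=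
  ⟨(memLp_two_quasihomogeneous n (memLp_radialPow n.natAbs)).toLp _,
    _, harmonicOnNhd_monomial n, MemLp.coeFn_toLp _⟩

theorem coeFn_monomial (n : ℤ) :
    (monomial n : L2Disk) =ᵐ[diskMeasure] quasihomogeneous n (radialPow n.natAbs) :=
  MemLp.coeFn_toLp (memLp_two_quasihomogeneous n (memLp_radialPow n.natAbs))

theorem hasFourierCoeff_monomial (n : ℤ) :
    HasFourierCoeff (quasihomogeneous n (radialPow n.natAbs)) n (2 * π) := by
  intro r hr
  have hle : -π ≤ π := by linarith [Real.pi_pos]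
  rw [intervalIntegral.integral_of_le hle]
  have : ∀ θ ∈ Ioc (-π) π, quasihomogeneous n (radialPow n.natAbs) (circleMap 0 r θ) *
      exp (-(n * θ * I)) = (r : ℂ) ^ n.natAbs := by
    intro θ hθ
    rw [quasihomogeneous_circleMap n _ hr.1 hθ, radialPow, mul_right_comm, ← exp_add,
      add_neg_cancel, exp_zero, one_mul]
  rw [setIntegral_congr_fun measurableSet_Ioc this, ← intervalIntegral.integral_of_le hle,
    intervalIntegral.integral_const, Complex.real_smul]
  push_cast
  ring

/-- The angular integral isolates the n-th Fourier coefficient of h, so only a radial integral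
remains; the +1 in the exponent is the Jacobian. -/
theorem integral_quasihomogeneous_mul_conj {n : ℤ} {Φ : ℝ → ℂ}
    (hΦ : MemLp Φ ∞ (volume.restrict (Ioo (0 : ℝ) 1))) {h : ℂ → ℂ} (hh : MemLp h 2 diskMeasure)
    {c : ℂ} (hc : HasFourierCoeff h n c) :
    ∫ z, quasihomogeneous n Φ z * conj (h z) ∂diskMeasure =
      (π : ℂ)⁻¹ * conj c * ∫ r in (0 : ℝ)..1, Φ r * (r : ℂ) ^ (n.natAbs + 1) := by
  have hle : -π ≤ π := by linarith [Real.pi_pos]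
  have hi : Integrable (fun z => quasihomogeneous n Φ z * conj (h z)) diskMeasure :=
    (memLp_two_quasihomogeneous n hΦ).integrable_mul hh.star
  rw [integral_diskMeasure hi, mul_assoc (π : ℂ)⁻¹]
  congr 1
  rw [← intervalIntegral.integral_const_mul, intervalIntegral.integral_of_le zero_le_one,
    intervalIntegral.integral_of_le zero_le_one, integral_Ioc_eq_integral_Ioo,
    integral_Ioc_eq_integral_Ioo]
  refine setIntegral_congr_fun measurableSet_Ioo fun r hr => ?_
  have h1 := congrArg conj (hc r hr)
  rw [intervalIntegral.integral_of_le hle, ← integral_conj, map_mul, map_pow, conj_ofReal] at h1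
  have h2 : ∫ θ in (-π)..π, quasihomogeneous n Φ (circleMap 0 r θ) * conj (h (circleMap 0 r θ))
      = Φ r * (conj c * (r : ℂ) ^ n.natAbs) := by
    rw [← h1, intervalIntegral.integral_of_le hle, ← integral_const_mul]
    refine setIntegral_congr_fun measurableSet_Ioc fun θ hθ => ?_
    rw [quasihomogeneous_circleMap n _ hr.1 hθ, map_mul, ← exp_conj]
    simp only [map_neg, map_mul, conj_ofReal, conj_I, map_intCast, mul_neg, neg_neg]
    ring
  rw [h2]
  ring

theorem radialMellin_natCast_add_two (φ : ℝ → ℂ) (N : ℕ) :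
    radialMellin φ (N + 2) = ∫ r in (0 : ℝ)..1, φ r * (r : ℂ) ^ (N + 1) := by
  rw [radialMellin]
  congr 1
  ext r
  rw [← cpow_natCast]
  congr 2
  push_cast
  ring

/-! ### Matrix coefficients of Toeplitz operators -/

/-- The projection disappears because w already lies in L²_h. -/
theorem inner_toeplitz (f : LinftyDisk) (u w : harmonicBergman) :
    inner ℂ w (toeplitz f u) =
      ∫ z, f z * (u : L2Disk) z * conj ((w : L2Disk) z) ∂diskMeasure := by
  rw [toeplitz, ContinuousLinearMap.comp_apply,
    Submodule.inner_orthogonalProjectionOnto_eq_of_mem_left, L2.inner_def]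
  refine integral_congr_ae ?_
  filter_upwards [(ContinuousLinearMap.mul ℂ ℂ).coeFn_holder (r := 2) f (u : L2Disk)] with z hz
  rw [RCLike.inner_apply]
  congr 1

theorem inner_toeplitz_quasihomogeneous_monomial (p n : ℤ) {φ : ℝ → ℂ}
    (hφ : MemLp φ ∞ (volume.restrict (Ioo (0 : ℝ) 1))) (w : harmonicBergman) {h : ℂ → ℂ}
    (hw : w =ᵐ[diskMeasure] h) {c : ℂ} (hc : HasFourierCoeff h (p + n) c) :
    inner ℂ w (toeplitz (quasihomogeneousSymbol p φ hφ) (monomial n)) =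
      (π : ℂ)⁻¹ * conj c * radialMellin φ ((n.natAbs + (p + n).natAbs : ℕ) + 2) := by
  have hh : MemLp h 2 diskMeasure := (memLp_congr_ae hw).1 (Lp.memLp _)
  have hm : MemLp (φ * radialPow n.natAbs) ∞ (volume.restrict (Ioo (0 : ℝ) 1)) :=
    (memLp_radialPow n.natAbs).mul hφ
  rw [inner_toeplitz, radialMellin_natCast_add_two]
  have e : ∫ z, quasihomogeneousSymbol p φ hφ z * (monomial n : L2Disk) z *
      conj ((w : L2Disk) z) ∂diskMeasure =
      ∫ z, quasihomogeneous (p + n) (φ * radialPow n.natAbs) z * conj (h z) ∂diskMeasure := by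
    refine integral_congr_ae ?_
    filter_upwards [hw, coeFn_monomial n, MemLp.coeFn_toLp (memLp_quasihomogeneous p hφ)]
      with z h1 h2 h3
    rw [h1, h2, quasihomogeneousSymbol, h3, quasihomogeneous_mul]
  rw [e, integral_quasihomogeneous_mul_conj hm hh hc]
  congr 2
  ext r
  simp only [Pi.mul_apply, radialPow]
  ring

theorem inner_monomial (n : ℤ) (w : harmonicBergman) {h : ℂ → ℂ} (hw : w =ᵐ[diskMeasure] h)
    {c : ℂ} (hc : HasFourierCoeff h n c) :
    inner ℂ w (monomial n) = (π : ℂ)⁻¹ * conj c * (2 * n.natAbs + 2 : ℂ)⁻¹ := by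
  have hh : MemLp h 2 diskMeasure := (memLp_congr_ae hw).1 (Lp.memLp _)
  rw [Submodule.coe_inner, L2.inner_def]
  have e : ∫ z, inner ℂ ((w : L2Disk) z) ((monomial n : L2Disk) z) ∂diskMeasure =
      ∫ z, quasihomogeneous n (radialPow n.natAbs) z * conj (h z) ∂diskMeasure := by
    refine integral_congr_ae ?_
    filter_upwards [hw, coeFn_monomial n] with z h1 h2
    rw [h1, h2, RCLike.inner_apply]
  rw [e, integral_quasihomogeneous_mul_conj (memLp_radialPow _) hh hc]
  congr 1
  simp only [radialPow, ← pow_add]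
  simp_rw [← ofReal_pow]
  rw [intervalIntegral.integral_ofReal, integral_pow]
  push_cast
  rw [one_pow, zero_pow (by positivity), sub_zero, one_div]
  congr 1
  ring

theorem inner_smul_harmonicBergman (a : ℂ) (u w : harmonicBergman) :
    inner ℂ w (a • u) = a * inner ℂ w u :=
  inner_smul_right w u a

/-- The eigenvalues of a radial Toeplitz operator. -/
def radialEigenvalue (ψ : ℝ → ℂ) (k : ℕ) : ℂ :=
  (2 * k + 2) * radialMellin ψ ((k + k : ℕ) + 2)

theorem radialSymbol_eq (ψ : ℝ → ℂ) (hψ : MemLp ψ ∞ (volume.restrict (Ioo (0 : ℝ) 1))) :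
    radialSymbol ψ hψ = quasihomogeneousSymbol 0 ψ hψ := by
  refine MemLp.toLp_congr _ _ (Eventually.of_forall fun z => ?_)
  simp [quasihomogeneous]

/-- Against any w, both sides are multiples of the same n-th Fourier coefficient of w; the factor
2|n|+2 in the eigenvalue undoes ∫ r^{2|n|+1} dr. -/
theorem toeplitz_radialSymbol_monomial {ψ : ℝ → ℂ}
    (hψ : MemLp ψ ∞ (volume.restrict (Ioo (0 : ℝ) 1))) (n : ℤ) :
    toeplitz (radialSymbol ψ hψ) (monomial n) = radialEigenvalue ψ n.natAbs • monomial n := by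
  refine ext_inner_left ℂ fun w => ?_
  obtain ⟨h, hh, hw⟩ := w.2
  obtain ⟨c, hc⟩ := exists_hasFourierCoeff hh n
  rw [radialSymbol_eq, inner_toeplitz_quasihomogeneous_monomial 0 n hψ w hw
    (by rwa [zero_add]), inner_smul_harmonicBergman, inner_monomial n w hw hc, zero_add, radialEigenvalue]
  have h0 : (2 * n.natAbs + 2 : ℂ) ≠ 0 := by
    exact_mod_cast (by positivity : (2 * n.natAbs + 2 : ℝ) ≠ 0)
  generalize (2 * n.natAbs + 2 : ℂ) = x at *
  field_simp

/-- The product of e_n with the conjugate of e_{p+n} is e^{-ipθ} r^{|n|+|p+n|}, whose phase does not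
involve n. This is the rigidity of Toeplitz operators behind the theorem. -/
theorem inner_toeplitz_monomial_congr (f : LinftyDisk) (p : ℤ) {m n : ℤ}
    (h : m.natAbs + (p + m).natAbs = n.natAbs + (p + n).natAbs) :
    inner ℂ (monomial (p + m)) (toeplitz f (monomial m)) =
      inner ℂ (monomial (p + n)) (toeplitz f (monomial n)) := by
  have key : ∀ n : ℤ, inner ℂ (monomial (p + n)) (toeplitz f (monomial n)) =
      ∫ z, f z * quasihomogeneous (-p) (radialPow (n.natAbs + (p + n).natAbs)) z
        ∂diskMeasure := by
    intro n
    rw [inner_toeplitz]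
    refine integral_congr_ae ?_
    filter_upwards [coeFn_monomial n, coeFn_monomial (p + n)] with z h1 h2
    rw [h1, h2, mul_assoc, conj_quasihomogeneous, quasihomogeneous_mul]
    congr 2
    · ring
    · ext r
      simp [radialPow, pow_add]
  rw [key, key, h]

/-! ### Products of a quasihomogeneous and a radial Toeplitz operator -/

section Product

variable {p : ℤ} {φ ψ : ℝ → ℂ} {hφ : MemLp φ ∞ (volume.restrict (Ioo (0 : ℝ) 1))}
  {hψ : MemLp ψ ∞ (volume.restrict (Ioo (0 : ℝ) 1))}

theorem radialEigenvalue_eq_of_isToeplitz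
    (hT : IsToeplitz (toeplitz (quasihomogeneousSymbol p φ hφ) ∘L toeplitz (radialSymbol ψ hψ)))
    {m n : ℤ} (h : m.natAbs + (p + m).natAbs = n.natAbs + (p + n).natAbs)
    (h0 : radialMellin φ ((n.natAbs + (p + n).natAbs : ℕ) + 2) ≠ 0) :
    radialEigenvalue ψ m.natAbs = radialEigenvalue ψ n.natAbs := by
  obtain ⟨f, hf⟩ := hT
  -- The factor 2 is π⁻¹ times the coefficient 2π of `hasFourierCoeff_monomial`.
  have key : ∀ n : ℤ, inner ℂ (monomial (p + n)) (toeplitz f (monomial n)) =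
      radialEigenvalue ψ n.natAbs *
        (2 * radialMellin φ ((n.natAbs + (p + n).natAbs : ℕ) + 2)) := by
    intro n
    rw [← hf, ContinuousLinearMap.comp_apply, toeplitz_radialSymbol_monomial, map_smul,
      inner_smul_harmonicBergman, inner_toeplitz_quasihomogeneous_monomial p n hφ _ (coeFn_monomial _)
        (hasFourierCoeff_monomial _)]
    congr 1
    rw [map_mul, conj_ofReal, map_ofNat]
    have : (π : ℂ) ≠ 0 := by exact_mod_cast Real.pi_ne_zero
    field_simp
  have e := inner_toeplitz_monomial_congr f p h
  rw [key, key, h] at e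
  exact mul_right_cancel₀ (mul_ne_zero two_ne_zero h0) e

/-- Strong induction: indices up to |p| are compared with 0 directly, larger ones are lowered by
|p|. -/
theorem radialEigenvalue_eq_zero_eigenvalue (hp : p ≠ 0)
    (hφ_mellin : ∀ k : ℕ, radialMellin φ (2 * (k : ℂ) + ((|p| : ℤ) : ℂ) + 2) ≠ 0)
    (hT : IsToeplitz (toeplitz (quasihomogeneousSymbol p φ hφ) ∘L toeplitz (radialSymbol ψ hψ)))
    (k : ℕ) : radialEigenvalue ψ k = radialEigenvalue ψ 0 := by
  have h0 : ∀ k N : ℕ, N = 2 * k + p.natAbs → radialMellin φ ((N : ℕ) + 2) ≠ 0 := by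
    rintro k N rfl
    convert hφ_mellin k using 2
    push_cast
    rw [Nat.cast_natAbs]
  induction k using Nat.strong_induction_on with
  | _ k ih =>
    rcases le_or_gt k p.natAbs with hk | hk
    -- The integer of modulus k between 0 and -p; there |n|+|p+n| = |p|, the same as at n = 0.
    · have hs : (-(p.sign * k)).natAbs = k := by
        simp [Int.natAbs_mul, Int.natAbs_sign_of_ne_zero hp]
      have hs' : (p + -(p.sign * k)).natAbs = p.natAbs - k := by
        rcases hp.lt_or_gt with h | h
        · rw [Int.sign_eq_neg_one_of_neg h]; omega
        · rw [Int.sign_eq_one_of_pos h]; omega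
      have e := radialEigenvalue_eq_of_isToeplitz hT (m := -(p.sign * k)) (n := 0)
        (by rw [hs, hs']; simp; omega) (h0 0 _ (by simp))
      rwa [hs] at e
    · obtain ⟨j, rfl⟩ := Nat.exists_eq_add_of_lt hk
      -- Now k = |p|+i. The indices sign(p)·i and its reflection -p - sign(p)·i have moduli i and
      -- |p|+i, and for both |n|+|p+n| = 2i+|p|.
      set i := j + 1 with hi
      have hs : (p.sign * i).natAbs = i := by
        simp [Int.natAbs_mul, Int.natAbs_sign_of_ne_zero hp]
      have hs' : (p + p.sign * i).natAbs = p.natAbs + i := by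
        rcases hp.lt_or_gt with h | h
        · rw [Int.sign_eq_neg_one_of_neg h]; omega
        · rw [Int.sign_eq_one_of_pos h]; omega
      have ht : (-p - p.sign * i).natAbs = p.natAbs + i := by
        rw [← hs', ← Int.natAbs_neg]
        congr 1
        ring
      have ht' : (p + (-p - p.sign * i)).natAbs = i := by
        rw [← Int.natAbs_neg]
        convert hs using 2
        ring
      have e := radialEigenvalue_eq_of_isToeplitz hT (m := -p - p.sign * i) (n := p.sign * i)
        (by rw [hs, hs', ht, ht']; omega) (h0 i _ (by rw [hs, hs']; omega))
      rw [hs, ht] at e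
      rw [show p.natAbs + j + 1 = p.natAbs + i by omega, e]
      -- The descent is strict because |p| > 0.
      exact ih i (by have := Int.natAbs_pos.2 hp; omega)

end Product

/-! ### Completeness of the even powers on the unit interval -/

/-- A continuous g on [0,1] is a uniform limit of polynomials in r²: apply Weierstrass to s ↦ g(√s).
Hence G annihilates every smooth test function supported in (0,1). -/
theorem ae_eq_zero_of_forall_integral_pow_eq_zero {G : ℝ → ℂ} (hG : IntegrableOn G (Ioo 0 1))
    (h : ∀ k : ℕ, ∫ r in Ioo (0 : ℝ) 1, (r ^ (2 * k)) • G r = 0) :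
    ∀ᵐ r ∂volume.restrict (Ioo (0 : ℝ) 1), G r = 0 := by
  rw [ae_restrict_iff' measurableSet_Ioo]
  have hbd : ∀ g : ℝ → ℝ, Continuous g →
      IntegrableOn (fun r => g r • G r) (Ioo 0 1) := by
    intro g hg
    obtain ⟨M, hM⟩ := (isCompact_Icc (a := (0 : ℝ)) (b := 1)).exists_bound_of_continuousOn
      hg.continuousOn
    refine Integrable.bdd_smul hG M hg.aestronglyMeasurable ?_
    filter_upwards [ae_restrict_mem measurableSet_Ioo] with r hr
    exact hM r (Ioo_subset_Icc_self hr)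
  have hpoly : ∀ P : Polynomial ℝ, ∫ r in Ioo (0 : ℝ) 1, (P.eval (r ^ 2)) • G r = 0 := by
    intro P
    simp_rw [Polynomial.eval_eq_sum_range, Finset.sum_smul]
    rw [integral_finsetSum _ fun i _ => hbd _ (by fun_prop)]
    refine Finset.sum_eq_zero fun i _ => ?_
    simp_rw [mul_smul, ← pow_mul]
    rw [integral_smul, h i, smul_zero]
  refine isOpen_Ioo.ae_eq_zero_of_integral_contDiff_smul_eq_zero hG.locallyIntegrableOn ?_
  intro g hg _ hsupp
  have hsub : Function.support (fun r => g r • G r) ⊆ Ioo 0 1 := fun r hr =>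
    hsupp (subset_tsupport g fun h0 => hr (by simp [h0]))
  rw [← setIntegral_eq_integral_of_forall_compl_eq_zero (s := Ioo (0 : ℝ) 1)
    fun r hr => by_contra fun h0 => hr (hsub h0)]
  have hgc := hg.continuous
  rw [← norm_le_zero_iff]
  refine le_of_forall_pos_le_add fun ε hε => ?_
  rw [zero_add]
  set N := ∫ r in Ioo (0 : ℝ) 1, ‖G r‖ with hN
  have hN0 : 0 ≤ N := integral_nonneg fun _ => norm_nonneg _
  -- The resulting error is at most εN/(N+1) ≤ ε; the +1 covers N = 0.
  obtain ⟨P, hP⟩ := exists_polynomial_near_of_continuousOn 0 1 (fun s => g (√s))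
    (hgc.comp Real.continuous_sqrt).continuousOn (ε / (N + 1)) (by positivity)
  have e : ∫ r in Ioo (0 : ℝ) 1, g r • G r
      = ∫ r in Ioo (0 : ℝ) 1, (g r - P.eval (r ^ 2)) • G r := by
    simp_rw [sub_smul]
    rw [integral_sub (hbd g hgc) (hbd _ (by fun_prop)), hpoly, sub_zero]
  rw [e]
  have hle : ‖∫ r in Ioo (0 : ℝ) 1, (g r - P.eval (r ^ 2)) • G r‖
      ≤ ∫ r in Ioo (0 : ℝ) 1, ε / (N + 1) * ‖G r‖ := by
    refine norm_integral_le_of_norm_le (hG.norm.const_mul _) ?_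
    filter_upwards [ae_restrict_mem measurableSet_Ioo] with r hr
    rw [norm_smul]
    refine mul_le_mul_of_nonneg_right ?_ (norm_nonneg _)
    have := (hP (r ^ 2) ⟨by positivity, pow_le_one₀ hr.1.le hr.2.le⟩).le
    simp only [Real.sqrt_sq hr.1.le] at this
    rwa [Real.norm_eq_abs, abs_sub_comm]
  refine hle.trans ?_
  rw [integral_const_mul, ← hN, div_mul_eq_mul_div, div_le_iff₀ (by positivity)]
  nlinarith

theorem ae_eq_const_of_radialEigenvalue_eq {ψ : ℝ → ℂ}
    (hψ : MemLp ψ ∞ (volume.restrict (Ioo (0 : ℝ) 1)))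
    {c : ℂ} (h : ∀ k, radialEigenvalue ψ k = c) :
    ∀ᵐ r ∂volume.restrict (Ioo (0 : ℝ) 1), ψ r = c := by
  have hint : ∀ {χ : ℝ → ℂ}, MemLp χ ∞ (volume.restrict (Ioo (0 : ℝ) 1)) → ∀ N : ℕ,
      IntegrableOn (fun r => χ r * (r : ℂ) ^ N) (Ioo 0 1) := fun hχ N =>
    memLp_one_iff_integrable.1 (((memLp_radialPow N).mul hχ).mono_exponent le_top)
  have hsub : MemLp (fun r => ψ r - c) ∞ (volume.restrict (Ioo (0 : ℝ) 1)) :=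
    hψ.sub (memLp_const c)
  -- Applied to (ψ - c)·r: the factor r turns the even powers into the odd powers r^{2k+1} occurring
  -- in the eigenvalues, and is cancelled at the end since r > 0.
  have h1 := ae_eq_zero_of_forall_integral_pow_eq_zero (hint hsub 1) fun k => by
    have e1 : ∫ r in Ioo (0 : ℝ) 1, ψ r * (r : ℂ) ^ (2 * k + 1) = c / (2 * k + 2) := by
      have h0 : (2 * k + 2 : ℂ) ≠ 0 := by
        exact_mod_cast (by positivity : (2 * k + 2 : ℝ) ≠ 0)
      rw [eq_div_iff h0, ← h k, radialEigenvalue, radialMellin_natCast_add_two,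
        intervalIntegral.integral_of_le zero_le_one, integral_Ioc_eq_integral_Ioo, mul_comm,
        two_mul k]
    have e2 : ∫ r in Ioo (0 : ℝ) 1, c * (r : ℂ) ^ (2 * k + 1) = c / (2 * k + 2) := by
      rw [integral_const_mul, ← integral_Ioc_eq_integral_Ioo,
        ← intervalIntegral.integral_of_le zero_le_one]
      simp_rw [← ofReal_pow]
      rw [intervalIntegral.integral_ofReal, integral_pow]
      push_cast
      rw [one_pow, zero_pow (by positivity), sub_zero, mul_one_div]
      congr 1
      ring
    have e3 : ∀ r : ℝ, (r ^ (2 * k)) • ((ψ r - c) * (r : ℂ) ^ 1)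
        = ψ r * (r : ℂ) ^ (2 * k + 1) - c * (r : ℂ) ^ (2 * k + 1) := by
      intro r
      rw [Complex.real_smul]
      push_cast
      ring
    simp_rw [e3]
    rw [integral_sub (hint hψ _) (hint (memLp_const c) _), e1, e2, sub_self]
  filter_upwards [h1, ae_restrict_mem measurableSet_Ioo] with r hr hr0
  have : (r : ℂ) ^ 1 ≠ 0 := by
    rw [pow_one]
    exact_mod_cast hr0.1.ne'
  exact sub_eq_zero.1 ((mul_eq_zero.1 hr).resolve_right this)

end

end HarmonicBergman

theorem theorem2 (p : ℤ) (hp : p ≠ 0)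
    (φ : ℝ → ℂ)
    (hφ : MeasureTheory.MemLp φ ⊤ (MeasureTheory.volume.restrict (Set.Ioo (0 : ℝ) 1)))
    (hφ_mellin : ∀ k : ℕ,
      HarmonicBergman.radialMellin φ (2 * (k : ℂ) + ((|p| : ℤ) : ℂ) + 2) ≠ 0)
    (ψ : ℝ → ℂ)
    (hψ : MeasureTheory.MemLp ψ ⊤ (MeasureTheory.volume.restrict (Set.Ioo (0 : ℝ) 1)))
    (hT : HarmonicBergman.IsToeplitz
      (HarmonicBergman.toeplitz (HarmonicBergman.quasihomogeneousSymbol p φ hφ) ∘L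
        HarmonicBergman.toeplitz (HarmonicBergman.radialSymbol ψ hψ))) :
    ∃ c : ℂ, ∀ᵐ r ∂(MeasureTheory.volume.restrict (Set.Ioo (0 : ℝ) 1)), ψ r = c :=
  ⟨_, HarmonicBergman.ae_eq_const_of_radialEigenvalue_eq hψ
    (HarmonicBergman.radialEigenvalue_eq_zero_eigenvalue hp hφ_mellin hT)⟩
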